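/- Write ordinals $\alpha<\omega^\omega$ in Cantor normal form $\alpha=\omega^{n_0}+\dots+\omega^{n_{k-1}}$ with $n_0\ge\dots\ge n_{k-1}$ in $\mathbb{N}$. For $m\in\mathbb{N}$ put $0[m]=0$, $(\beta+1)[m]=\beta$, and $(\beta+\omega^{j})[m]=\beta+\omega^{j-1}\cdot m$ for $j\ge1$, where in both cases the last summand of the Cantor normal form is the one displayed. A finite set $X=\{x_0<\dots<x_{\ell-1}\}\subseteq\mathbb{N}$ is called $\alpha$-large if $\alpha[x_0][x_1]\cdots[x_{\ell-1}]=0$. Theorem. Let $n\in\mathbb{N}$ and let $X\subseteq\mathbb{N}$ be a finite set with $\min X\ge 3$ that is $\omega^{300n}$-large. Then for every colouring $P:[X]^2\to\{0,1\}$ of the two-element subsets of $X$ there is a set $Y\subseteq X$ that is $\omega^n$-large and $P$-homogeneous, i.e. $P$ is constant on $[Y]^2$. -/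

import Mathlib

namespace KetonenSolovay

/-- Ordinals `α < ω ^ ω` in Cantor normal form `α = ω ^ n₀ + ⋯ + ω ^ nₖ₋₁` with `n₀ ≥ ⋯ ≥ nₖ₋₁`.
The exponents are listed from the last (lowest) summand to the first, so `exps = [nₖ₋₁, …, n₀]`. -/
@[ext]
structure CNF where
  exps : List ℕ
  sorted : exps.Pairwise (· ≤ ·)

namespace CNF

/-- The ordinal `0`: the empty sum. -/
def zero : CNF := ⟨[], List.Pairwise.nil⟩

instance : Zero CNF := ⟨zero⟩

/-- The ordinal `ω ^ n`. -/
def omegaPow (n : ℕ) : CNF := ⟨[n], List.pairwise_singleton _ n⟩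

/-- The list of exponents of `α[m]`, where `0[m] = 0`, `(β + 1)[m] = β` and
`(β + ω ^ (n + 1))[m] = β + ω ^ n * m`. -/
def fundExps (m : ℕ) : List ℕ → List ℕ
  | [] => []
  | 0 :: l => l
  | (n + 1) :: l => List.replicate m n ++ l

theorem fundExps_sorted (m : ℕ) {l : List ℕ} (h : l.Pairwise (· ≤ ·)) :
    (fundExps m l).Pairwise (· ≤ ·) := by
  match l, h with
  | [], _ => exact List.Pairwise.nil
  | 0 :: l, h => exact (List.pairwise_cons.1 h).2
  | (n + 1) :: l, h =>
    obtain ⟨h1, h2⟩ := List.pairwise_cons.1 h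
    refine List.pairwise_append.2 ⟨?_, h2, ?_⟩
    · exact List.pairwise_replicate.2 (Or.inr le_rfl)
    · intro a ha b hb
      rw [List.eq_of_mem_replicate ha]
      exact (Nat.le_succ n).trans (h1 b hb)

/-- The fundamental sequence operation `α[m]`. -/
def fund (α : CNF) (m : ℕ) : CNF := ⟨fundExps m α.exps, fundExps_sorted m α.sorted⟩

end CNF

/-- A finite set `X = {x₀ < ⋯ < xₗ₋₁}` is `α`-large if `α[x₀]⋯[xₗ₋₁] = 0`. -/
def IsLarge (α : CNF) (X : Finset ℕ) : Prop :=
  (X.sort (· ≤ ·)).foldl CNF.fund α = 0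

/-- `Y` is homogeneous for the colouring `P : [X]^n → k` if `P` is constant on `[Y]^n`. -/
def IsHomogeneous {X : Finset ℕ} {n k : ℕ} (P : X.powersetCard n → Fin k) (Y : Finset ℕ) : Prop :=
  ∀ s t : X.powersetCard n, s.1 ⊆ Y → t.1 ⊆ Y → P s = P t

/-- `X` is `RT^n_k`-`α`-large: every colouring `P : [X]^n → k` has an `α`-large homogeneous set. -/
def IsRTLarge (n k : ℕ) (α : CNF) (X : Finset ℕ) : Prop :=
  ∀ P : X.powersetCard n → Fin k, ∃ Y ⊆ X, IsHomogeneous P Y ∧ IsLarge α Y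

end KetonenSolovay

namespace KetonenSolovay

/-! ### Large sets through blocks -/

/-! Largeness is replaced by the upward closed notion `BlockLarge`: an element `x` followed by `x`
successive blocks of the next lower exponent. Two tools are needed. `BlockLarge.exists_filter` is a
pigeonhole principle costing one exponent, provided every element bounds the number of colours.
`BlockLarge.exists_sparse` extracts an exponentially growing subset by halving the exponent, up to a
constant; there, each element bounds the number of colour patterns over the smaller elements. The
Ramsey argument (`BlockLarge.exists_homogeneous`) is an induction on the sum of the exponents wanted
for the two colours. Eight exponents buy an `x` and `x` later blocks such that all pairs not inside
a block have one colour `b`. By induction each block contains a set of colour `b` with the exponent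
for `b` lowered by one, or a set of the other colour of full size. In the second case the proof is
over; otherwise `x` and the union of the sets of colour `b` regain the lost exponent. Target
exponents `n`, `n` need `16 * n` on a sparse set, hence `32 * n + 3` before thinning. -/

/-- Every element of `A` is smaller than every element of `B`. -/
def Precedes (A B : Finset ℕ) : Prop := ∀ x ∈ A, ∀ y ∈ B, x < y

/-- `X` contains an `ω ^ n`-large subset, phrased through blocks: an `ω ^ (n + 1)`-large set consists
of an element `x` followed by `x` successive `ω ^ n`-large sets. -/
def BlockLarge : ℕ → Finset ℕ → Prop
  | 0, X => X.Nonempty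
  | n + 1, X => ∃ x ∈ X, ∃ f : ℕ → Finset ℕ,
      (∀ i < x, f i ⊆ X ∧ (∀ y ∈ f i, x < y) ∧ BlockLarge n (f i)) ∧
      ∀ i j, i < j → j < x → Precedes (f i) (f j)

theorem Precedes.mono {A B A' B' : Finset ℕ} (h : Precedes A B) (hA : A' ⊆ A) (hB : B' ⊆ B) :
    Precedes A' B' := fun x hx y hy => h x (hA hx) y (hB hy)

theorem BlockLarge.mono {n : ℕ} {X Y : Finset ℕ} (h : BlockLarge n X) (hXY : X ⊆ Y) :
    BlockLarge n Y := by
  cases n with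
  | zero => exact Finset.Nonempty.mono hXY h
  | succ n =>
    obtain ⟨x, hx, f, hf, hlt⟩ := h
    exact ⟨x, hXY hx, f, fun i hi => ⟨(hf i hi).1.trans hXY, (hf i hi).2⟩, hlt⟩

theorem BlockLarge.nonempty {n : ℕ} {X : Finset ℕ} (h : BlockLarge n X) : X.Nonempty := by
  cases n with
  | zero => exact h
  | succ n => obtain ⟨x, hx, -⟩ := h; exact ⟨x, hx⟩

theorem BlockLarge.of_le {m n : ℕ} (hmn : m ≤ n) {X : Finset ℕ} (h0 : ∀ x ∈ X, 3 ≤ x)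
    (h : BlockLarge n X) : BlockLarge m X := by
  induction n, hmn using Nat.le_induction generalizing X with
  | base => exact h
  | succ n _ ih =>
    obtain ⟨x, hx, f, hf, -⟩ := h
    obtain ⟨h1, -, h3⟩ := hf 0 (by have := h0 x hx; omega)
    exact (ih (fun y hy => h0 y (h1 hy)) h3).mono h1

/-- Blocks indexed by an arbitrary finite set of natural numbers can be indexed by an initial
segment. -/
theorem exists_reindex_range {I : Finset ℕ} {a : ℕ} (ha : a ≤ I.card) :
    ∃ e : ℕ → ℕ, (∀ i < a, e i ∈ I) ∧ ∀ i j, i < j → j < a → e i < e j := by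
  refine ⟨fun i => if h : i < I.card then I.orderEmbOfFin rfl ⟨i, h⟩ else 0, ?_, ?_⟩
  · intro i hi
    have : i < I.card := by omega
    simp only [this, dif_pos]
    exact I.orderEmbOfFin_mem rfl _
  · intro i j hij hj
    have h1 : i < I.card := by omega
    have h2 : j < I.card := by omega
    simp only [h1, h2, dif_pos]
    exact (I.orderEmbOfFin rfl).strictMono hij

/-! ### Runs of the fundamental sequence operation on lists -/

/-- The exponents of `α[x₀]⋯[xₗ₋₁]`. -/
def runExps (A l : List ℕ) : List ℕ := l.foldl (fun A x => CNF.fundExps x A) A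

@[simp] theorem runExps_nil (A : List ℕ) : runExps A [] = A := rfl

@[simp] theorem runExps_cons (A l : List ℕ) (x : ℕ) :
    runExps A (x :: l) = runExps (CNF.fundExps x A) l := rfl

theorem runExps_append (A l₁ l₂ : List ℕ) :
    runExps A (l₁ ++ l₂) = runExps (runExps A l₁) l₂ := List.foldl_append ..

@[simp] theorem runExps_zero (l : List ℕ) : runExps [] l = [] := by
  induction l with
  | nil => rfl
  | cons x l ih => simpa [CNF.fundExps] using ih

theorem exps_foldl_fund (α : CNF) (l : List ℕ) :
    (l.foldl CNF.fund α).exps = runExps α.exps l := by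
  induction l generalizing α with
  | nil => rfl
  | cons x l ih => simpa [CNF.fund] using ih (α.fund x)

theorem foldl_fund_eq_zero_iff (n : ℕ) (l : List ℕ) :
    l.foldl CNF.fund (CNF.omegaPow n) = 0 ↔ runExps [n] l = [] := by
  rw [CNF.ext_iff, exps_foldl_fund]
  rfl

theorem fundExps_append (x a : ℕ) (A S : List ℕ) :
    CNF.fundExps x (a :: A ++ S) = CNF.fundExps x (a :: A) ++ S := by
  cases a <;> simp [CNF.fundExps]

/-- The lower summands are consumed first, so the list splits at the moment `A` is exhausted. -/
theorem runExps_append_eq_nil {A S l : List ℕ} (h : runExps (A ++ S) l = []) :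
    ∃ l₁ l₂, l = l₁ ++ l₂ ∧ runExps A l₁ = [] ∧ runExps S l₂ = [] := by
  induction l generalizing A with
  | nil =>
    have : A = [] ∧ S = [] := by simpa using h
    exact ⟨[], [], rfl, by simp [this.1], by simp [this.2]⟩
  | cons x l ih =>
    cases A with
    | nil => exact ⟨[], x :: l, rfl, rfl, h⟩
    | cons a A =>
      rw [runExps_cons, fundExps_append] at h
      obtain ⟨l₁, l₂, rfl, h1, h2⟩ := ih h
      exact ⟨x :: l₁, l₂, rfl, h1, h2⟩

theorem exists_blocks_of_runExps {n k : ℕ} {l : List ℕ} (hl : l.SortedLT)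
    (h : runExps (List.replicate k n) l = []) :
    ∃ f : ℕ → List ℕ, (∀ i < k, (f i).SortedLT ∧ f i ⊆ l ∧ runExps [n] (f i) = []) ∧
      ∀ i j, i < j → j < k → Precedes (f i).toFinset (f j).toFinset := by
  induction k generalizing l with
  | zero => exact ⟨fun _ => [], by simp, by simp⟩
  | succ k ih =>
    rw [List.replicate_succ, ← List.singleton_append] at h
    obtain ⟨l₁, l₂, rfl, h1, h2⟩ := runExps_append_eq_nil h
    have hp := List.pairwise_append.1 hl.pairwise
    obtain ⟨f, hf, hlt⟩ := ih hp.2.1.sortedLT h2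
    refine ⟨fun i => Nat.casesOn i l₁ f, ?_, ?_⟩
    · rintro (_ | i) hi
      · exact ⟨hp.1.sortedLT, List.subset_append_left _ _, h1⟩
      · obtain ⟨a, b, c⟩ := hf i (by omega)
        exact ⟨a, List.Subset.trans b (List.subset_append_right _ _), c⟩
    · rintro (_ | i) (_ | j) hij hj
      · omega
      · intro x hx y hy
        exact hp.2.2 x (by simpa using hx) y ((hf j (by omega)).2.1 (by simpa using hy))
      · omega
      · exact hlt i j (by omega) (by omega)

theorem blockLarge_of_runExps {n : ℕ} {l : List ℕ} (hl : l.SortedLT) (h : runExps [n] l = []) :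
    BlockLarge n l.toFinset := by
  induction n generalizing l with
  | zero =>
    cases l with
    | nil => simp at h
    | cons x l => exact ⟨x, by simp⟩
  | succ n ih =>
    cases l with
    | nil => simp at h
    | cons x l =>
      have hp := List.pairwise_cons.1 hl.pairwise
      simp only [runExps_cons, CNF.fundExps, List.append_nil] at h
      obtain ⟨f, hf, hlt⟩ := exists_blocks_of_runExps hp.2.sortedLT h
      refine ⟨x, by simp, fun i => (f i).toFinset, fun i hi => ⟨?_, ?_, ?_⟩, hlt⟩
      · intro y hy
        have := (hf i hi).2.1 (by simpa using hy)
        simp [this]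
      · intro y hy
        exact hp.1 y ((hf i hi).2.1 (by simpa using hy))
      · exact ih (hf i hi).1 (hf i hi).2.2

theorem IsLarge.blockLarge {n : ℕ} {X : Finset ℕ} (h : IsLarge (CNF.omegaPow n) X) :
    BlockLarge n X := by
  have := blockLarge_of_runExps (Finset.sortedLT_sort X) ((foldl_fund_eq_zero_iff n _).1 h)
  simpa using this

theorem exists_exact_concat {n k : ℕ} {X : Finset ℕ} {f : ℕ → List ℕ}
    (hf : ∀ i < k, (f i).SortedLT ∧ (∀ y ∈ f i, y ∈ X) ∧ ∀ S, runExps (n :: S) (f i) = S)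
    (hlt : ∀ i j, i < j → j < k → ∀ x ∈ f i, ∀ y ∈ f j, x < y) :
    ∃ l : List ℕ, l.SortedLT ∧ (∀ y ∈ l, y ∈ X ∧ ∃ i < k, y ∈ f i) ∧
      ∀ S, runExps (List.replicate k n ++ S) l = S := by
  induction k with
  | zero => exact ⟨[], List.Pairwise.nil.sortedLT, by simp, by simp⟩
  | succ k ih =>
    obtain ⟨l, h1, h2, h3⟩ := ih (fun i hi => hf i (by omega))
      (fun i j hij hj => hlt i j hij (by omega))
    obtain ⟨g1, g2, g3⟩ := hf k (by omega)
    refine ⟨l ++ f k, (List.pairwise_append.2 ⟨h1.pairwise, g1.pairwise, ?_⟩).sortedLT, ?_, ?_⟩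
    · intro x hx y hy
      obtain ⟨-, i, hi, hxi⟩ := h2 x hx
      exact hlt i k hi (by omega) x hxi y hy
    · intro y hy
      rcases List.mem_append.1 hy with hy | hy
      · obtain ⟨a, i, hi, b⟩ := h2 y hy
        exact ⟨a, i, by omega, b⟩
      · exact ⟨g2 y hy, k, by omega, hy⟩
    · intro S
      rw [List.replicate_succ', List.append_assoc, runExps_append, h3]
      exact g3 S

/-- Quantifying over the higher summands `S` forces the run to use up `ω ^ n` with no element to
spare. Such runs can be concatenated; a surplus element would start consuming `S`. -/
theorem BlockLarge.exists_exact {n : ℕ} {X : Finset ℕ} (h : BlockLarge n X) :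
    ∃ l : List ℕ, l.SortedLT ∧ (∀ y ∈ l, y ∈ X) ∧ ∀ S, runExps (n :: S) l = S := by
  induction n generalizing X with
  | zero =>
    obtain ⟨x, hx⟩ := h
    exact ⟨[x], (List.pairwise_singleton _ _).sortedLT, by simpa using hx,
      by simp [CNF.fundExps]⟩
  | succ n ih =>
    obtain ⟨x, hx, f, hf, hlt⟩ := h
    have key : ∀ i, ∃ l : List ℕ, i < x →
        (l.SortedLT ∧ (∀ y ∈ l, y ∈ f i) ∧ ∀ S, runExps (n :: S) l = S) := by
      intro i
      by_cases hi : i < x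
      · obtain ⟨l, hl⟩ := ih (hf i hi).2.2
        exact ⟨l, fun _ => hl⟩
      · exact ⟨[], fun h => absurd h hi⟩
    choose g hg using key
    obtain ⟨l, h1, h2, h3⟩ := exists_exact_concat (X := X) (f := g) (k := x) (n := n)
      (fun i hi => ⟨(hg i hi).1, fun y hy => (hf i hi).1 ((hg i hi).2.1 y hy), (hg i hi).2.2⟩)
      (fun i j hij hj a ha b hb => hlt i j hij hj a ((hg i (hij.trans hj)).2.1 a ha) b
        ((hg j hj).2.1 b hb))
    refine ⟨x :: l, (List.pairwise_cons.2 ⟨?_, h1.pairwise⟩).sortedLT, ?_, ?_⟩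
    · intro y hy
      obtain ⟨-, i, hi, hyi⟩ := h2 y hy
      exact (hf i hi).2.1 y ((hg i hi).2.1 y hyi)
    · intro y hy
      rcases List.mem_cons.1 hy with rfl | hy
      · exact hx
      · exact (h2 y hy).1
    · intro S
      exact h3 S

theorem BlockLarge.exists_isLarge {n : ℕ} {X : Finset ℕ} (h : BlockLarge n X) :
    ∃ Y ⊆ X, IsLarge (CNF.omegaPow n) Y := by
  obtain ⟨l, h1, h2, h3⟩ := h.exists_exact
  refine ⟨l.toFinset, fun y hy => h2 y (by simpa using hy), ?_⟩
  have hs : l.toFinset.sort (· ≤ ·) = l :=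
    (List.toFinset_sort (· ≤ ·) h1.nodup).2 (h1.pairwise.imp le_of_lt)
  rw [IsLarge, hs, foldl_fund_eq_zero_iff]
  exact h3 []

end KetonenSolovay

namespace KetonenSolovay

/-! ### Pigeonhole principle

The exponents of an ordinal are read as the heads of a hydra. Cutting always the smallest head is the
strategy that keeps the hydra alive longest. -/

/-- The heads that replace a head `j` cut off at stage `x`. -/
def regrow (x : ℕ) : ℕ → Multiset ℕ
  | 0 => 0
  | j + 1 => Multiset.replicate x j

theorem card_regrow_le (x s : ℕ) : (regrow x s).card ≤ x := by
  cases s <;> simp [regrow]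

theorem lt_of_mem_regrow {x s a : ℕ} (h : a ∈ regrow x s) : a < s := by
  cases s with
  | zero => simp [regrow] at h
  | succ s => rw [Multiset.eq_of_mem_replicate h]; omega

/-- Whichever heads are cut, the hydra `S` dies along `l`. -/
def Dies : Multiset ℕ → List ℕ → Prop
  | S, [] => S = 0
  | S, x :: l => ∀ j ∈ S, Dies (S.erase j + regrow x j) l

/-- `Dom z S T`: the hydra `S` arises from `T` by replacing each head with one that is not larger, or
with at most `z` smaller heads. -/
inductive Dom (z : ℕ) : Multiset ℕ → Multiset ℕ → Prop
  | zero : Dom z 0 0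
  | keep {s t : ℕ} {S T : Multiset ℕ} (hst : s ≤ t) (h : Dom z S T) : Dom z (s ::ₘ S) (t ::ₘ T)
  | drop {t : ℕ} {F S T : Multiset ℕ} (hc : F.card ≤ z) (hF : ∀ s ∈ F, s < t) (h : Dom z S T) :
      Dom z (F + S) (t ::ₘ T)

namespace Dom

theorem refl (z : ℕ) (S : Multiset ℕ) : Dom z S S := by
  induction S using Multiset.induction_on with
  | empty => exact zero
  | cons a S ih => exact keep le_rfl ih

theorem mono {z x : ℕ} (hzx : z ≤ x) {S T : Multiset ℕ} (h : Dom z S T) : Dom x S T := by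
  induction h with
  | zero => exact zero
  | keep hst _ ih => exact keep hst ih
  | drop hc hF _ ih => exact drop (hc.trans hzx) hF ih

theorem add {z : ℕ} {S T S' T' : Multiset ℕ} (h : Dom z S T) (h' : Dom z S' T') :
    Dom z (S + S') (T + T') := by
  induction h with
  | zero => simpa using h'
  | keep hst _ ih => simpa only [Multiset.cons_add] using keep hst ih
  | drop hc hF _ ih => simpa only [Multiset.cons_add, add_assoc] using drop hc hF ih

theorem zero_left (z : ℕ) (T : Multiset ℕ) : Dom z 0 T := by
  induction T using Multiset.induction_on with
  | empty => exact zero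
  | cons a T ih => simpa using drop (F := 0) (t := a) (by simp) (by simp) ih

theorem replicate {z m u : ℕ} {F : Multiset ℕ} (hc : F.card ≤ m) (hF : ∀ s ∈ F, s ≤ u) :
    Dom z F (Multiset.replicate m u) := by
  induction F using Multiset.induction_on generalizing m with
  | empty => exact zero_left _ _
  | cons a F ih =>
    rw [Multiset.card_cons] at hc
    obtain ⟨m, rfl⟩ : ∃ m', m = m' + 1 := ⟨m - 1, by omega⟩
    rw [Multiset.replicate_succ]
    exact keep (hF a (by simp)) (ih (by omega) fun s hs => hF s (by simp [hs]))

theorem regrow {x s t : ℕ} (hst : s ≤ t) : Dom x (regrow x s) (regrow x t) := by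
  cases s with
  | zero => exact zero_left _ _
  | succ s =>
    obtain ⟨t, rfl⟩ : ∃ t', t = t' + 1 := ⟨t - 1, by omega⟩
    refine replicate (card_regrow_le _ _) fun a ha => ?_
    have := lt_of_mem_regrow ha
    omega

end Dom

/-- A cut in `S` is answered by cutting the head of `T` above it. If `s` is one of at most `z ≤ x`
heads lying below `t = u + 1`, cutting `t` yields `x` copies of `u`: one of them dominates the
regrowth of `s`, the other `x - 1` dominate the remaining small heads. -/
theorem Dom.exists_cut {z x : ℕ} (hzx : z ≤ x) {S T : Multiset ℕ} (h : Dom z S T) {s : ℕ}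
    (hs : s ∈ S) : ∃ t ∈ T, Dom x (S.erase s + KetonenSolovay.regrow x s)
      (T.erase t + KetonenSolovay.regrow x t) := by
  induction h with
  | zero => simp at hs
  | @keep a t S T hst h ih =>
    by_cases hsa : s = a
    · subst hsa
      refine ⟨t, by simp, ?_⟩
      simpa using (h.mono hzx).add (Dom.regrow hst)
    · obtain ⟨t', ht', h'⟩ := ih (by simpa [hsa] using hs)
      refine ⟨t', by simp [ht'], ?_⟩
      rw [Multiset.erase_cons_tail _ (by simpa using fun h => hsa h.symm)]
      by_cases htt : t' = t
      · subst htt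
        rw [Multiset.erase_cons_head, ← Multiset.cons_erase ht']
        simpa only [Multiset.cons_add] using Dom.keep hst h'
      · rw [Multiset.erase_cons_tail _ (by simpa using fun h => htt h.symm)]
        simpa only [Multiset.cons_add] using Dom.keep hst h'
  | @drop t F S T hc hF h ih =>
    by_cases hsF : s ∈ F
    · refine ⟨t, by simp, ?_⟩
      have hst := hF s hsF
      obtain ⟨u, rfl⟩ : ∃ u, t = u + 1 := ⟨t - 1, by omega⟩
      obtain ⟨F, rfl⟩ := Multiset.exists_cons_of_mem hsF
      rw [Multiset.card_cons] at hc
      obtain ⟨y, rfl⟩ : ∃ y, x = y + 1 := ⟨x - 1, by omega⟩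
      have h1 : Dom (y + 1) (KetonenSolovay.regrow (y + 1) s) {u} := by
        have := Dom.drop (z := y + 1) (t := u) (card_regrow_le (y + 1) s)
          (fun a ha => by have := lt_of_mem_regrow ha; omega) Dom.zero
        simpa using this
      have h2 : Dom (y + 1) F (Multiset.replicate y u) :=
        Dom.replicate (by omega) fun a ha => by
          have := hF a (by simp [ha]); omega
      have h3 := ((h.mono hzx).add (h1.add h2))
      have e1 : (s ::ₘ F + S).erase s + KetonenSolovay.regrow (y + 1) s =
          S + (KetonenSolovay.regrow (y + 1) s + F) := by
        rw [Multiset.cons_add, Multiset.erase_cons_head]; abel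
      have e2 : ((u + 1) ::ₘ T).erase (u + 1) + KetonenSolovay.regrow (y + 1) (u + 1) =
          T + ({u} + Multiset.replicate y u) := by
        rw [Multiset.erase_cons_head, KetonenSolovay.regrow, Multiset.replicate_succ,
          Multiset.singleton_add]
      rw [e1, e2]
      exact h3
    · obtain ⟨t', ht', h'⟩ := ih (by simpa [hsF] using hs)
      refine ⟨t', by simp [ht'], ?_⟩
      rw [Multiset.erase_add_right_neg _ hsF, add_assoc]
      by_cases htt : t' = t
      · subst htt
        rw [Multiset.erase_cons_head, ← Multiset.cons_erase ht']
        simpa only [Multiset.cons_add] using Dom.drop (hc.trans hzx) hF h'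
      · rw [Multiset.erase_cons_tail _ (by simpa using fun h => htt h.symm)]
        simpa only [Multiset.cons_add] using Dom.drop (hc.trans hzx) hF h'

theorem Dies.of_dom {z : ℕ} {S T : Multiset ℕ} {l : List ℕ} (hl : l.SortedLT)
    (hz : ∀ x ∈ l, z ≤ x) (h : Dom z S T) (hT : Dies T l) : Dies S l := by
  induction l generalizing z S T with
  | nil =>
    have hT : T = 0 := hT
    subst hT
    generalize hU : (0 : Multiset ℕ) = U at h
    cases h with
    | zero => rfl
    | keep _ _ => simp at hU
    | drop _ _ _ => simp at hU
  | cons x l ih =>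
    intro s hs
    have hp := List.pairwise_cons.1 hl.pairwise
    obtain ⟨t, ht, h'⟩ := h.exists_cut (hz x (by simp)) hs
    exact ih hp.2.sortedLT (fun y hy => (hp.1 y hy).le) h' (hT t ht)

theorem coe_fundExps_cons (x a : ℕ) (A : List ℕ) :
    (CNF.fundExps x (a :: A) : Multiset ℕ) = A + regrow x a := by
  cases a with
  | zero => simp [CNF.fundExps, regrow]
  | succ a =>
    rw [CNF.fundExps, regrow, ← Multiset.coe_replicate, add_comm, Multiset.coe_add]

/-- The fundamental sequence always cuts the smallest head `m`. Cutting a larger `j` instead leaves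
a dominated hydra, so it dies no later. -/
theorem dies_of_runExps {A l : List ℕ} (hA : A.Pairwise (· ≤ ·)) (hl : l.SortedLT)
    (h : runExps A l = []) : Dies A l := by
  induction l generalizing A with
  | nil =>
    have h : A = [] := h
    subst h
    rfl
  | cons x l ih =>
    have hp := List.pairwise_cons.1 hl.pairwise
    have ih' := ih (CNF.fundExps_sorted x hA) hp.2.sortedLT h
    intro j hj
    cases A with
    | nil => simp at hj
    | cons m A =>
      rw [coe_fundExps_cons] at ih'
      rw [← Multiset.cons_coe] at hj ⊢
      by_cases hjm : j = m
      · subst hjm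
        simpa using ih'
      · have hjA : j ∈ (A : Multiset ℕ) := by simpa [hjm] using hj
        have hmj : m < j :=
          lt_of_le_of_ne ((List.pairwise_cons.1 hA).1 j (by simpa using hjA)) (Ne.symm hjm)
        -- The heads `m` and the regrowth of `j` are at most `x + 1` heads below `j`. The bound `x +
        -- 1` is affordable because all later elements exceed `x`.
        refine Dies.of_dom (z := x + 1) hp.2.sortedLT (fun y hy => hp.1 y hy) ?_ ih'
        rw [Multiset.erase_cons_tail _ (by simpa using fun h => hjm h.symm)]
        have hd : Dom (x + 1) ((m ::ₘ regrow x j) + (A : Multiset ℕ).erase j)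
            (j ::ₘ (A : Multiset ℕ).erase j) := by
          refine Dom.drop ?_ ?_ (Dom.refl _ _)
          · simpa using card_regrow_le x j
          · intro s hs
            rcases Multiset.mem_cons.1 hs with rfl | hs
            · exact hmj
            · exact lt_of_mem_regrow hs
        rw [Multiset.cons_erase hjA] at hd
        have := hd.add (Dom.zero_left (x + 1) (regrow x m))
        convert this using 1
        rw [add_zero, Multiset.cons_add, Multiset.cons_add, add_comm]

/-- Each colour owns a part of one hydra, and an element cuts the smallest head of its own colour's
part. Since every strategy kills the hydra, some part is exhausted using only elements of its
colour. -/
theorem exists_runExps_filter_eq_nil {κ : Type*} [DecidableEq κ] (f : ℕ → κ) {I : Finset κ}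
    (hI : I.Nonempty) {l : List ℕ} (hf : ∀ x ∈ l, f x ∈ I) (α : κ → List ℕ)
    (h : Dies (∑ i ∈ I, (α i : Multiset ℕ)) l) :
    ∃ i ∈ I, runExps (α i) (l.filter (fun x => f x = i)) = [] := by
  induction l generalizing α with
  | nil =>
    obtain ⟨i, hi⟩ := hI
    refine ⟨i, hi, ?_⟩
    have h : ∑ i ∈ I, (α i : Multiset ℕ) = 0 := h
    simpa using (Finset.sum_eq_zero_iff.1 h) i hi
  | cons x l ih =>
    have hx : f x ∈ I := hf x (by simp)
    rcases hα : α (f x) with _ | ⟨a, A⟩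
    · exact ⟨f x, hx, by rw [hα, runExps_zero]⟩
    · have ha : a ∈ ∑ i ∈ I, (α i : Multiset ℕ) :=
        Multiset.mem_sum.2 ⟨f x, hx, by simp [hα]⟩
      have h' := h a ha
      have e : (∑ i ∈ I, (α i : Multiset ℕ)).erase a + regrow x a =
          ∑ i ∈ I, (Function.update α (f x) (CNF.fundExps x (a :: A)) i : Multiset ℕ) := by
        rw [← Finset.add_sum_erase _ _ hx, ← Finset.add_sum_erase _ _ hx, Function.update_self,
          coe_fundExps_cons, hα, ← Multiset.cons_coe, Multiset.cons_add,
          Multiset.erase_cons_head, add_right_comm]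
        congr 1
        refine Finset.sum_congr rfl fun i hi => ?_
        rw [Function.update_of_ne (Finset.ne_of_mem_erase hi)]
      rw [e] at h'
      obtain ⟨i, hi, hr⟩ := ih (fun y hy => hf y (by simp [hy])) _ h'
      refine ⟨i, hi, ?_⟩
      by_cases hix : f x = i
      · subst hix
        rw [Function.update_self] at hr
        rw [List.filter_cons_of_pos (by simp), hα]
        exact hr
      · rw [Function.update_of_ne (Ne.symm hix)] at hr
        rw [List.filter_cons_of_neg (by simpa using hix)]
        exact hr

/-- Pigeonhole principle: if the elements of an `ω ^ (n + 1)`-large set bound the number of colours,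
then one of the colours contains an `ω ^ n`-large set. -/
theorem BlockLarge.exists_filter {κ : Type*} [DecidableEq κ] {n : ℕ} {X : Finset ℕ}
    (h : BlockLarge (n + 1) X) (f : ℕ → κ) (I : Finset κ) (hf : ∀ x ∈ X, f x ∈ I)
    (hX : ∀ x ∈ X, I.card ≤ x) : ∃ i ∈ I, BlockLarge n (X.filter (fun x => f x = i)) := by
  obtain ⟨l, h1, h2, h3⟩ := h.exists_exact
  have hr := h3 []
  cases l with
  | nil => simp at hr
  | cons x l =>
    have hp := List.pairwise_cons.1 h1.pairwise
    have hr : runExps (List.replicate x n) l = [] := by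
      simpa [CNF.fundExps] using hr
    have hd := dies_of_runExps (List.pairwise_replicate.2 (Or.inr le_rfl)) hp.2.sortedLT hr
    have hd' : Dies (∑ i ∈ I, (([n] : List ℕ) : Multiset ℕ)) l := by
      -- One head `n` per colour makes at most `x` heads, dominated by the `x` heads left after the
      -- first element.
      refine Dies.of_dom (z := x) hp.2.sortedLT (fun y hy => (hp.1 y hy).le) ?_ hd
      rw [Multiset.coe_replicate]
      refine Dom.replicate ?_ ?_
      · simpa using hX x (h2 x (by simp))
      · intro s hs
        obtain ⟨-, -, hs⟩ := Multiset.mem_sum.1 hs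
        exact (by simpa using hs : s = n).le
    obtain ⟨i, hi, hi'⟩ := exists_runExps_filter_eq_nil f ⟨f x, hf x (h2 x (by simp))⟩
      (fun y hy => hf y (h2 y (by simp [hy]))) (fun _ => [n]) hd'
    refine ⟨i, hi, (blockLarge_of_runExps (hp.2.filter _).sortedLT hi').mono ?_⟩
    intro y hy
    simp only [List.mem_toFinset, List.mem_filter, decide_eq_true_eq] at hy
    exact Finset.mem_filter.2 ⟨h2 y (by simp [hy.1]), hy.2⟩

end KetonenSolovay

namespace KetonenSolovay

/-! ### Sparse sets -/

/-- The elements of `X` are at least `3` and grow exponentially. -/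
def Sparse (X : Finset ℕ) : Prop :=
  (∀ x ∈ X, 3 ≤ x) ∧ ∀ x ∈ X, ∀ y ∈ X, x < y → 2 ^ (2 * x + 1) ≤ y

theorem Sparse.mono {X Y : Finset ℕ} (h : Sparse Y) (hXY : X ⊆ Y) : Sparse X :=
  ⟨fun x hx => h.1 x (hXY hx), fun x hx y hy => h.2 x (hXY hx) y (hXY hy)⟩

theorem sparse_singleton {x : ℕ} (hx : 3 ≤ x) : Sparse {x} := by
  refine ⟨by simpa using hx, fun a ha b hb hab => ?_⟩
  simp only [Finset.mem_singleton] at ha hb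
  omega

theorem two_mul_lt_of_blockLarge_one {S : Finset ℕ} (h : BlockLarge 1 S) {u w : ℕ}
    (hu : ∀ y ∈ S, u < y) (hw : ∀ y ∈ S, y < w) : 2 * u < w := by
  obtain ⟨y, hy, f, hf, hlt⟩ := h
  have key : ∀ i < y, ∀ z ∈ f i, y + i < z := by
    intro i
    induction i with
    | zero => exact fun hi z hz => (hf 0 hi).2.1 z hz
    | succ i ih =>
      intro hi z hz
      obtain ⟨v, hv⟩ := (hf i (by omega)).2.2.nonempty
      have h1 := ih (by omega) v hv
      have h2 := hlt i (i + 1) (by omega) hi v hv z hz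
      omega
  have hyu := hu y hy
  obtain ⟨v, hv⟩ := (hf (y - 1) (by omega)).2.2.nonempty
  have h1 := key (y - 1) (by omega) v hv
  have h2 := hw v ((hf (y - 1) (by omega)).1 hv)
  omega

theorem two_pow_lt_of_blockLarge_two {S : Finset ℕ} (h : BlockLarge 2 S) {u w : ℕ}
    (hu : ∀ y ∈ S, u < y) (hw : ∀ y ∈ S, y < w) : 2 ^ u < w := by
  obtain ⟨y, hy, f, hf, hlt⟩ := h
  have hyu := hu y hy
  have key : ∀ i < y, ∀ z ∈ f i, 2 ^ i < z := by
    intro i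
    induction i with
    | zero =>
      intro hi z hz
      have := (hf 0 hi).2.1 z hz
      simp only [pow_zero]
      omega
    | succ i ih =>
      intro hi z hz
      have := two_mul_lt_of_blockLarge_one (hf i (by omega)).2.2 (ih (by omega))
        (fun v hv => hlt i (i + 1) (by omega) hi v hv z hz)
      rwa [pow_succ, mul_comm]
  obtain ⟨v, hv⟩ := (hf u hyu).2.2.nonempty
  exact (key u hyu v hv).trans (hw v ((hf u hyu).1 hv))

/-- An `ω`-large gap doubles, an `ω ^ 2`-large gap exponentiates, and two successive `ω ^ 2`-large
blocks give `2 ^ 2 ^ u`. -/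
theorem two_pow_le_of_blockLarge_three {S : Finset ℕ} (h : BlockLarge 3 S) {u w : ℕ}
    (hu3 : 3 ≤ u) (hu : ∀ y ∈ S, u < y) (hw : ∀ y ∈ S, y < w) : 2 ^ (2 * u + 1) ≤ w := by
  obtain ⟨y, hy, f, hf, hlt⟩ := h
  have hyu := hu y hy
  have h1 : ∀ z ∈ f 1, 2 ^ u < z := fun z hz =>
    two_pow_lt_of_blockLarge_two (hf 0 (by omega)).2.2
      (fun v hv => hu v ((hf 0 (by omega)).1 hv))
      (fun v hv => hlt 0 1 (by omega) (by omega) v hv z hz)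
  have h2 : 2 ^ 2 ^ u < w := two_pow_lt_of_blockLarge_two (hf 1 (by omega)).2.2 h1
    (fun v hv => hw v ((hf 1 (by omega)).1 hv))
  have h3 : 2 * u + 1 ≤ 2 ^ u := by
    clear * - hu3
    induction u, hu3 using Nat.le_induction with
    | base => norm_num
    | succ u _ ih => rw [pow_succ]; omega
  exact (Nat.pow_le_pow_right (by norm_num) h3).trans h2.le

theorem BlockLarge.exists_sparse {n : ℕ} {X : Finset ℕ} (h3 : ∀ x ∈ X, 3 ≤ x)
    (h : BlockLarge (2 * n + 3) X) : ∃ Y ⊆ X, Sparse Y ∧ BlockLarge n Y := by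
  induction n generalizing X with
  | zero =>
    obtain ⟨x, hx⟩ := h.nonempty
    exact ⟨{x}, by simpa using hx, sparse_singleton (h3 x hx), ⟨x, by simp⟩⟩
  | succ n ih =>
    obtain ⟨x, hx, f, hf, hlt⟩ : BlockLarge ((2 * n + 3 + 1) + 1) X := h
    have hx3 := h3 x hx
    have hfX : ∀ i < x, ∀ y ∈ f i, 3 ≤ y := fun i hi y hy => h3 y ((hf i hi).1 hy)
    have h0 := hf 0 (by omega)
    have h1 := hf 1 (by omega)
    obtain ⟨z, hz, g, hg, hglt⟩ := h1.2.2
    -- Block `0` serves only to make `z` exceed `2 * x`. Of the `z` blocks inside block `1`, the odd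
    -- ones are thinned and the even ones are buffers.
    have hxz : 2 * x < z := two_mul_lt_of_blockLarge_one
      (h0.2.2.of_le (by omega) (hfX 0 (by omega))) h0.2.1
      (fun v hv => hlt 0 1 (by omega) (by omega) v hv z hz)
    have hgX : ∀ i < z, g i ⊆ X := fun i hi => (hg i hi).1.trans h1.1
    have hxg : ∀ i < z, ∀ y ∈ g i, x < y := fun i hi y hy => h1.2.1 y ((hg i hi).1 hy)
    have hg3 : ∀ i < z, ∀ y ∈ g i, 3 ≤ y := fun i hi y hy => h3 y (hgX i hi hy)
    have buffer : ∀ i, i + 1 < z → ∀ u, 3 ≤ u → (∀ y ∈ g i, u < y) →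
        ∀ w ∈ g (i + 1), 2 ^ (2 * u + 1) ≤ w := fun i hi u hu hug w hw =>
      two_pow_le_of_blockLarge_three ((hg i (by omega)).2.2.of_le (by omega) (hg3 i (by omega))) hu
        hug (fun v hv => hglt i (i + 1) (by omega) hi v hv w hw)
    have key : ∀ i, ∃ Y : Finset ℕ, i < x → Y ⊆ g (2 * i + 1) ∧ Sparse Y ∧ BlockLarge n Y := by
      intro i
      by_cases hi : i < x
      · obtain ⟨Y, hY⟩ := ih (hg3 (2 * i + 1) (by omega)) (hg (2 * i + 1) (by omega)).2.2
        exact ⟨Y, fun _ => hY⟩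
      · exact ⟨∅, fun h => absurd h hi⟩
    choose Y hY using key
    have hYX : ∀ i < x, Y i ⊆ X := fun i hi => (hY i hi).1.trans (hgX _ (by omega))
    have hxY : ∀ i < x, ∀ y ∈ Y i, x < y := fun i hi y hy => hxg _ (by omega) y ((hY i hi).1 hy)
    have hYlt : ∀ i j, i < j → j < x → Precedes (Y i) (Y j) := fun i j hij hj =>
      (hglt (2 * i + 1) (2 * j + 1) (by omega) (by omega)).mono (hY i (by omega)).1 (hY j hj).1
    refine ⟨insert x ((Finset.range x).biUnion Y), ?_, ⟨?_, ?_⟩, x, by simp, Y, ?_, hYlt⟩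
    · intro y hy
      simp only [Finset.mem_insert, Finset.mem_biUnion, Finset.mem_range] at hy
      rcases hy with rfl | ⟨i, hi, hy⟩
      · exact hx
      · exact hYX i hi hy
    · intro y hy
      simp only [Finset.mem_insert, Finset.mem_biUnion, Finset.mem_range] at hy
      rcases hy with rfl | ⟨i, hi, hy⟩
      · exact hx3
      · exact h3 y (hYX i hi hy)
    · intro a ha b hb hab
      simp only [Finset.mem_insert, Finset.mem_biUnion, Finset.mem_range] at ha hb
      rcases hb with rfl | ⟨j, hj, hb⟩
      · rcases ha with rfl | ⟨i, hi, ha⟩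
        · omega
        · have := hxY i hi a ha
          omega
      · rcases ha with rfl | ⟨i, hi, ha⟩
        · exact buffer (2 * j) (by omega) _ hx3 (hxg _ (by omega)) b ((hY j hj).1 hb)
        · rcases lt_trichotomy i j with hij | rfl | hij
          · exact buffer (2 * j) (by omega) a (h3 a (hYX i hi ha))
              (fun v hv => hglt (2 * i + 1) (2 * j) (by omega) (by omega) a ((hY i hi).1 ha) v hv)
              b ((hY j hj).1 hb)
          · exact (hY i hi).2.1.2 a ha b hb hab
          · have := hYlt j i hij hi b hb a ha
            omega
    · intro i hi
      refine ⟨?_, hxY i hi, (hY i hi).2.2⟩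
      exact (Finset.subset_biUnion_of_mem Y (Finset.mem_range.2 hi)).trans
        (Finset.subset_insert _ _)

end KetonenSolovay

namespace KetonenSolovay

/-! ### Homogeneous sets for colourings of pairs -/

/-- Finite Ramsey theorem for pairs and two colours. -/
theorem exists_homogeneous_of_two_pow_le_card (c : ℕ → ℕ → Bool) (p : Bool → ℕ) {S : Finset ℕ}
    (hS : 2 ^ (p true + p false) ≤ S.card) :
    ∃ b, ∃ H ⊆ S, p b ≤ H.card ∧ ∀ i ∈ H, ∀ j ∈ H, i < j → c i j = b := by
  induction hs : p true + p false generalizing p S with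
  | zero => exact ⟨true, ∅, by simp, by omega, by simp⟩
  | succ s ih =>
    by_cases h0 : ∃ b, p b = 0
    · obtain ⟨b, hb⟩ := h0
      exact ⟨b, ∅, by simp, by omega, by simp⟩
    push Not at h0
    rw [hs] at hS
    have hne : S.Nonempty := Finset.card_pos.1 (lt_of_lt_of_le (by positivity) hS)
    set m := S.min' hne with hm
    have hmS : m ∈ S := S.min'_mem hne
    obtain ⟨b, hb⟩ : ∃ b, 2 ^ s ≤ ((S.erase m).filter (fun x => c m x = b)).card := by
      by_contra! hcon
      have h1 := Finset.card_filter_add_card_filter_not (s := S.erase m) (fun x => c m x = true)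
      simp only [Bool.not_eq_true] at h1
      have h2 := Finset.card_erase_of_mem hmS
      have h3 := hcon true
      have h4 := hcon false
      rw [pow_succ] at hS
      omega
    have hps : Function.update p b (p b - 1) true + Function.update p b (p b - 1) false = s := by
      have := h0 true
      have := h0 false
      cases b <;> simp <;> omega
    obtain ⟨b', H, hH, hcard, hhom⟩ := ih (Function.update p b (p b - 1)) (by rwa [hps]) hps
    have hHS : H ⊆ S := fun x hx => Finset.mem_of_mem_erase (Finset.mem_filter.1 (hH hx)).1
    by_cases hbb : b' = b
    · subst hbb
      have hmH : m ∉ H := fun h => by simpa using hH h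
      refine ⟨b', insert m H, Finset.insert_subset hmS hHS, ?_, ?_⟩
      · rw [Finset.card_insert_of_notMem hmH]
        rw [Function.update_self] at hcard
        omega
      · intro i hi j hj hij
        rcases Finset.mem_insert.1 hj with rfl | hj
        · rcases Finset.mem_insert.1 hi with rfl | hi
          · omega
          · have := S.min'_le i (hHS hi)
            omega
        · rcases Finset.mem_insert.1 hi with rfl | hi
          · exact (Finset.mem_filter.1 (hH hj)).2
          · exact hhom i hi j hj hij
    · rw [Function.update_of_ne hbb] at hcard
      exact ⟨b', H, hHS, hcard, hhom⟩

/-- A sparse set can be thinned so that all its elements have the same colours over the smaller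
elements of a given sparse set. -/
theorem BlockLarge.exists_end_homogeneous (c : ℕ → ℕ → Bool) {n : ℕ} {Z X F : Finset ℕ}
    (hZ : Sparse Z) (hX : X ⊆ Z) (hF : F ⊆ Z) (hFX : Precedes F X) (h : BlockLarge (n + 1) X) :
    ∃ Y ⊆ X, BlockLarge n Y ∧ ∀ x ∈ F, ∀ y ∈ Y, ∀ y' ∈ Y, c x y = c x y' := by
  -- Pigeonhole on the trace of `y` over `F`; sparsity bounds the `2 ^ F.card` traces by `y`.
  obtain ⟨t, -, ht⟩ := h.exists_filter (fun y => F.filter (fun x => c x y = true)) F.powerset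
    (fun y _ => by simp) (fun y hy => by
      rw [Finset.card_powerset]
      rcases F.eq_empty_or_nonempty with rfl | hne
      · have := hZ.1 y (hX hy)
        simp only [Finset.card_empty, pow_zero]
        omega
      · have hmem := F.max'_mem hne
        have hcard : F.card ≤ F.max' hne + 1 := by
          have : F ⊆ Finset.range (F.max' hne + 1) := fun x hx =>
            Finset.mem_range.2 (Nat.lt_succ_of_le (F.le_max' x hx))
          simpa using Finset.card_le_card this
        exact (Nat.pow_le_pow_right (by norm_num) (by omega)).trans
          (hZ.2 _ (hF hmem) y (hX hy) (hFX _ hmem y hy)))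
  refine ⟨_, Finset.filter_subset _ _, ht, ?_⟩
  intro x hx y hy y' hy'
  have heq := (Finset.mem_filter.1 hy).2.trans (Finset.mem_filter.1 hy').2.symm
  have hmem := Finset.ext_iff.1 heq x
  simp only [Finset.mem_filter, hx, true_and] at hmem
  exact Bool.eq_iff_iff.2 hmem

/-- A sparse `ω ^ (n + 3)`-large set contains an element `r` followed by `r` blocks that are
`ω ^ n`-large and such that the colour of a pair from two blocks depends only on the blocks. -/
theorem BlockLarge.exists_grouping (c : ℕ → ℕ → Bool) {n : ℕ} {X : Finset ℕ} (hX : Sparse X)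
    (h : BlockLarge (n + 3) X) :
    ∃ r ∈ X, ∃ f : ℕ → Finset ℕ, ∃ col : ℕ → ℕ → Bool,
      (∀ i < r, f i ⊆ X ∧ (∀ y ∈ f i, r < y) ∧ BlockLarge n (f i)) ∧
      (∀ i j, i < j → j < r → Precedes (f i) (f j)) ∧
      ∀ i j, i < j → j < r → ∀ x ∈ f i, ∀ y ∈ f j, c x y = col i j := by
  obtain ⟨r, hr, g, hg, hglt⟩ : BlockLarge ((n + 2) + 1) X := h
  -- First the colour is made independent of the upper element; then, testing against one
  -- representative per block, of the lower element too.
  have key : ∀ j, ∃ Y : Finset ℕ, j < r → Y ⊆ g j ∧ BlockLarge (n + 1) Y ∧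
      ∀ x ∈ X, (∀ y ∈ g j, x < y) → ∀ y ∈ Y, ∀ y' ∈ Y, c x y = c x y' := by
    intro j
    by_cases hj : j < r
    · obtain ⟨Y, h1, h2, h3⟩ := BlockLarge.exists_end_homogeneous c hX (hg j hj).1
        (Finset.filter_subset (fun x => ∀ y ∈ g j, x < y) X)
        (fun x hx => (Finset.mem_filter.1 hx).2) (hg j hj).2.2
      exact ⟨Y, fun _ => ⟨h1, h2, fun x hx hxy => h3 x (Finset.mem_filter.2 ⟨hx, hxy⟩)⟩⟩
    · exact ⟨∅, fun h => absurd h hj⟩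
  choose Y hY using key
  have hrep : ∀ j, ∃ y, j < r → y ∈ Y j := by
    intro j
    by_cases hj : j < r
    · obtain ⟨y, hy⟩ := (hY j hj).2.1.nonempty
      exact ⟨y, fun _ => hy⟩
    · exact ⟨0, fun h => absurd h hj⟩
  choose rep hrep using hrep
  have key' : ∀ i, ∃ F : Finset ℕ, ∃ t : Finset ℕ, i < r → F ⊆ Y i ∧ BlockLarge n F ∧
      ∀ x ∈ F, (Finset.range r).filter (fun j => c x (rep j) = true) = t := by
    intro i
    by_cases hi : i < r
    · obtain ⟨t, -, ht⟩ := (hY i hi).2.1.exists_filter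
        (fun x => (Finset.range r).filter (fun j => c x (rep j) = true)) (Finset.range r).powerset
        (fun x _ => by simp) (fun x hx => by
          have hxg := (hY i hi).1 hx
          rw [Finset.card_powerset, Finset.card_range]
          exact (Nat.pow_le_pow_right (by norm_num) (by omega)).trans
            (hX.2 r hr x ((hg i hi).1 hxg) ((hg i hi).2.1 x hxg)))
      exact ⟨_, t, fun _ => ⟨Finset.filter_subset _ _, ht, fun x hx => (Finset.mem_filter.1 hx).2⟩⟩
    · exact ⟨∅, ∅, fun h => absurd h hi⟩
  choose F t hF using key'
  refine ⟨r, hr, F, fun i j => decide (j ∈ t i), ?_, ?_, ?_⟩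
  · intro i hi
    have hsub := (hF i hi).1.trans (hY i hi).1
    exact ⟨hsub.trans (hg i hi).1, fun y hy => (hg i hi).2.1 y (hsub hy), (hF i hi).2.1⟩
  · intro i j hij hj
    exact (hglt i j hij hj).mono ((hF i (hij.trans hj)).1.trans (hY i (hij.trans hj)).1)
      ((hF j hj).1.trans (hY j hj).1)
  · intro i j hij hj x hx y hy
    have hi := hij.trans hj
    have hxg := (hY i hi).1 ((hF i hi).1 hx)
    have e : c x y = c x (rep j) := (hY j hj).2.2 x ((hg i hi).1 hxg)
      (fun v hv => hglt i j hij hj x hxg v hv) y ((hF j hj).1 hy) _ (hrep j hj)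
    have hm := Finset.ext_iff.1 ((hF i hi).2.2 x hx) j
    simp only [Finset.mem_filter, Finset.mem_range, hj, true_and] at hm
    rw [e, Bool.eq_iff_iff, hm]
    simp

/-- A sparse `ω ^ (n + 8)`-large set contains an element `x` followed by `x` blocks that are
`ω ^ n`-large, with one colour for all pairs that are not contained in a block. -/
theorem BlockLarge.exists_monochromatic_grouping (c : ℕ → ℕ → Bool) {n : ℕ} {X : Finset ℕ}
    (hX : Sparse X) (h : BlockLarge (n + 8) X) :
    ∃ b, ∃ x ∈ X, ∃ f : ℕ → Finset ℕ,
      (∀ i < x, f i ⊆ X ∧ (∀ y ∈ f i, x < y ∧ c x y = b) ∧ BlockLarge n (f i)) ∧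
      (∀ i j, i < j → j < x → Precedes (f i) (f j)) ∧
      ∀ i j, i < j → j < x → ∀ y ∈ f i, ∀ z ∈ f j, c y z = b := by
  obtain ⟨x, hx, f, hf, -⟩ : BlockLarge ((n + 7) + 1) X := h
  have hx3 := hX.1 x hx
  obtain ⟨h1, h2, h3⟩ := hf 0 (by omega)
  obtain ⟨b, -, hb⟩ := BlockLarge.exists_filter (n := n + 6) h3 (fun y => c x y) Finset.univ
    (fun _ _ => Finset.mem_univ _) (fun y hy => by
      have := hX.1 y (h1 hy)
      simp only [Finset.card_univ, Fintype.card_bool]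
      omega)
  generalize hR : (f 0).filter (fun y => c x y = b) = R at hb
  have hRX : R ⊆ X := by
    subst hR
    exact (Finset.filter_subset _ _).trans h1
  have hRx : ∀ y ∈ R, x < y ∧ c x y = b := by
    subst hR
    exact fun y hy => ⟨h2 y (Finset.mem_filter.1 hy).1, (Finset.mem_filter.1 hy).2⟩
  obtain ⟨r, hr, g, col, hg, hglt, hgc⟩ :=
    BlockLarge.exists_grouping (n := n + 3) c (hX.mono hRX) hb
  have hxr := (hRx r hr).1
  -- If a block pair has the colour other than `b`, any `u` in block `i` sees block `j` in that
  -- colour while `x` sees it in `b`. So block `j` has a head available for either colour.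
  by_cases hall : ∀ i j, i < j → j < x → col i j = b
  · refine ⟨b, x, hx, g, ?_, fun i j hij hj => hglt i j hij (by omega), ?_⟩
    · intro i hi
      obtain ⟨g1, g2, g3⟩ := hg i (by omega)
      exact ⟨g1.trans hRX, fun y hy => hRx y (g1 hy),
        g3.of_le (by omega) fun y hy => hX.1 y (hRX (g1 hy))⟩
    · intro i j hij hj y hy z hz
      rw [hgc i j hij (by omega) y hy z hz, hall i j hij hj]
  · push Not at hall
    obtain ⟨i, j, hij, hj, hcol⟩ := hall
    have hi' : i < r := by omega
    have hj' : j < r := by omega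
    obtain ⟨u, hu⟩ := (hg i hi').2.2.nonempty
    have huX := hRX ((hg i hi').1 hu)
    have hxu := (hRx u ((hg i hi').1 hu)).1
    have hjX := (hg j hj').1.trans hRX
    obtain ⟨s, hs, e, col', he, helt, hec⟩ :=
      BlockLarge.exists_grouping (n := n) c (hX.mono hjX) (hg j hj').2.2
    have hus : 2 ^ (2 * u + 1) ≤ s := hX.2 u huX s (hjX hs) (hglt i j hij hj' u hu s hs)
    -- Asking for `u` blocks serves both possible heads, as `x < u`.
    obtain ⟨b', H, hH, hcard, hhom⟩ := exists_homogeneous_of_two_pow_le_card col' (fun _ => u)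
      (S := Finset.range s) (by
        rw [Finset.card_range]
        exact (Nat.pow_le_pow_right (by norm_num) (by omega)).trans hus)
    obtain ⟨v, hvX, hvu, hv⟩ : ∃ v ∈ X, v ≤ u ∧ ∀ y ∈ g j, v < y ∧ c v y = b' := by
      by_cases hbb : b' = b
      · subst hbb
        exact ⟨x, hx, hxu.le, fun y hy => hRx y ((hg j hj').1 hy)⟩
      · refine ⟨u, huX, le_rfl, fun y hy => ⟨hglt i j hij hj' u hu y hy, ?_⟩⟩
        rw [hgc i j hij hj' u hu y hy]
        revert hbb hcol
        cases b <;> cases b' <;> simp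
    obtain ⟨σ, hσ, hσlt⟩ := exists_reindex_range (a := v) (hvu.trans hcard)
    have hσs : ∀ k < v, σ k < s := fun k hk => Finset.mem_range.1 (hH (hσ k hk))
    refine ⟨b', v, hvX, fun k => e (σ k), ?_, ?_, ?_⟩
    · intro k hk
      obtain ⟨e1, -, e3⟩ := he (σ k) (hσs k hk)
      exact ⟨e1.trans hjX, fun y hy => hv y (e1 hy), e3⟩
    · intro k l hkl hl
      exact helt _ _ (hσlt k l hkl hl) (hσs l hl)
    · intro k l hkl hl y hy z hz
      rw [hec _ _ (hσlt k l hkl hl) (hσs l hl) y hy z hz]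
      exact hhom _ (hσ k (hkl.trans hl)) _ (hσ l hl) (hσlt k l hkl hl)

/-- A sparse `ω ^ (8 * (p + q))`-large set contains an `ω ^ p`-large homogeneous set of the first
colour or an `ω ^ q`-large homogeneous set of the second colour. -/
theorem BlockLarge.exists_homogeneous (c : ℕ → ℕ → Bool) (p : Bool → ℕ) {X : Finset ℕ}
    (hX : Sparse X) (h : BlockLarge (8 * (p true + p false)) X) :
    ∃ b, ∃ Y ⊆ X, BlockLarge (p b) Y ∧ ∀ x ∈ Y, ∀ y ∈ Y, x < y → c x y = b := by
  induction hs : p true + p false generalizing p X with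
  | zero =>
    obtain ⟨x, hx⟩ := h.nonempty
    have h0 : p true = 0 := by omega
    refine ⟨true, {x}, by simpa using hx, by rw [h0]; exact ⟨x, by simp⟩, ?_⟩
    intro y hy z hz hyz
    simp only [Finset.mem_singleton] at hy hz
    omega
  | succ s ih =>
    by_cases h0 : ∃ b, p b = 0
    · obtain ⟨b, hb⟩ := h0
      obtain ⟨x, hx⟩ := h.nonempty
      refine ⟨b, {x}, by simpa using hx, by rw [hb]; exact ⟨x, by simp⟩, ?_⟩
      intro y hy z hz hyz
      simp only [Finset.mem_singleton] at hy hz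
      omega
    push Not at h0
    rw [hs] at h
    obtain ⟨b, x, hx, f, hf, hlt, hc⟩ :=
      BlockLarge.exists_monochromatic_grouping (n := 8 * s) c hX h
    have hps : Function.update p b (p b - 1) true + Function.update p b (p b - 1) false = s := by
      have := h0 true
      have := h0 false
      cases b <;> simp <;> omega
    have ih' : ∀ i < x, ∃ b', ∃ Y ⊆ f i, BlockLarge (Function.update p b (p b - 1) b') Y ∧
        ∀ y ∈ Y, ∀ z ∈ Y, y < z → c y z = b' := fun i hi =>
      ih (Function.update p b (p b - 1)) (hX.mono (hf i hi).1) (by rw [hps]; exact (hf i hi).2.2) hps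
    by_cases hother : ∃ i < x, ∃ b', b' ≠ b ∧ ∃ Y ⊆ f i, BlockLarge (p b') Y ∧
        ∀ y ∈ Y, ∀ z ∈ Y, y < z → c y z = b'
    · obtain ⟨i, hi, b', -, Y, hY, hY'⟩ := hother
      exact ⟨b', Y, hY.trans (hf i hi).1, hY'⟩
    have key : ∀ i, ∃ Y : Finset ℕ, i < x → Y ⊆ f i ∧ BlockLarge (p b - 1) Y ∧
        ∀ y ∈ Y, ∀ z ∈ Y, y < z → c y z = b := by
      intro i
      by_cases hi : i < x
      · obtain ⟨b', Y, hY, hl, hh⟩ := ih' i hi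
        by_cases hbb : b' = b
        · subst hbb
          rw [Function.update_self] at hl
          exact ⟨Y, fun _ => ⟨hY, hl, hh⟩⟩
        · rw [Function.update_of_ne hbb] at hl
          exact absurd ⟨i, hi, b', hbb, Y, hY, hl, hh⟩ hother
      · exact ⟨∅, fun h => absurd h hi⟩
    choose Y hY using key
    refine ⟨b, insert x ((Finset.range x).biUnion Y), ?_, ?_, ?_⟩
    · intro y hy
      simp only [Finset.mem_insert, Finset.mem_biUnion, Finset.mem_range] at hy
      rcases hy with rfl | ⟨i, hi, hy⟩
      · exact hx
      · exact (hf i hi).1 ((hY i hi).1 hy)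
    · obtain ⟨m, hm⟩ : ∃ m, p b = m + 1 := ⟨p b - 1, by have := h0 b; omega⟩
      rw [hm] at hY ⊢
      refine ⟨x, by simp, Y, fun i hi => ⟨?_, ?_, (hY i hi).2.1⟩, fun i j hij hj => ?_⟩
      · exact (Finset.subset_biUnion_of_mem Y (Finset.mem_range.2 hi)).trans
          (Finset.subset_insert _ _)
      · exact fun y hy => ((hf i hi).2.1 y ((hY i hi).1 hy)).1
      · exact (hlt i j hij hj).mono (hY i (hij.trans hj)).1 (hY j hj).1
    · intro y hy z hz hyz
      simp only [Finset.mem_insert, Finset.mem_biUnion, Finset.mem_range] at hy hz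
      rcases hz with rfl | ⟨j, hj, hz⟩
      · rcases hy with rfl | ⟨i, hi, hy⟩
        · omega
        · have := ((hf i hi).2.1 y ((hY i hi).1 hy)).1
          omega
      · rcases hy with rfl | ⟨i, hi, hy⟩
        · exact ((hf j hj).2.1 z ((hY j hj).1 hz)).2
        · rcases lt_trichotomy i j with hij | rfl | hij
          · exact hc i j hij hj y ((hY i hi).1 hy) z ((hY j hj).1 hz)
          · exact (hY i hi).2.2 y hy z hz hyz
          · have := hlt j i hij hi z ((hY j hj).1 hz) y ((hY i hi).1 hy)
            omega

theorem isHomogeneous_of_colour {X Y : Finset ℕ} (P : X.powersetCard 2 → Fin 2) {b : Bool}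
    (h : ∀ x ∈ Y, ∀ y ∈ Y, x < y →
      decide (∃ s : X.powersetCard 2, s.1 = {x, y} ∧ P s = 0) = b) :
    IsHomogeneous P Y := by
  have key : ∀ s : X.powersetCard 2, s.1 ⊆ Y → decide (P s = 0) = b := by
    intro s hs
    obtain ⟨x, y, hxy, hsxy⟩ := Finset.card_eq_two.1 (Finset.mem_powersetCard.1 s.2).2
    wlog hlt : x < y generalizing x y
    · exact this y x hxy.symm (by rw [hsxy, Finset.pair_comm]) (by omega)
    have hx : x ∈ Y := hs (by rw [hsxy]; simp)
    have hy : y ∈ Y := hs (by rw [hsxy]; simp)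
    rw [← h x hx y hy hlt]
    refine decide_eq_decide.2 ⟨fun hP => ⟨s, hsxy, hP⟩, ?_⟩
    rintro ⟨s', hs', hP⟩
    rwa [← Subtype.ext (hs'.trans hsxy.symm)]
  intro s t hs ht
  have := decide_eq_decide.1 ((key s hs).trans (key t ht).symm)
  omega

end KetonenSolovay

theorem mainTheorem1 (n : ℕ) (X : Finset ℕ) (hmin : ∀ x ∈ X, 3 ≤ x)
    (hX : KetonenSolovay.IsLarge (KetonenSolovay.CNF.omegaPow (300 * n)) X) :
    KetonenSolovay.IsRTLarge 2 2 (KetonenSolovay.CNF.omegaPow n) X := by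
  open KetonenSolovay in
  intro P
  have hXl := hX.blockLarge
  obtain ⟨Z, hZX, hZ, hZl⟩ : ∃ Z ⊆ X, Sparse Z ∧ BlockLarge (8 * (n + n)) Z := by
    rcases Nat.eq_zero_or_pos n with rfl | hn
    · obtain ⟨x, hx⟩ := hXl.nonempty
      exact ⟨{x}, by simpa using hx, sparse_singleton (hmin x hx), ⟨x, by simp⟩⟩
    -- Here `2 * (16 * n) + 3 ≤ 300 * n` because `n` is positive.
    · exact BlockLarge.exists_sparse hmin (hXl.of_le (by omega) hmin)
  obtain ⟨b, Y, hYZ, hY, hhom⟩ := BlockLarge.exists_homogeneous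
    (fun x y => decide (∃ s : X.powersetCard 2, s.1 = {x, y} ∧ P s = 0)) (fun _ => n) hZ hZl
  obtain ⟨W, hWY, hW⟩ := hY.exists_isLarge
  exact ⟨W, (hWY.trans hYZ).trans hZX,
    isHomogeneous_of_colour P fun x hx y hy hxy => hhom x (hWY hx) y (hWY hy) hxy, hW⟩
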